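/- There is an absolute constant $c>0$ such that the following holds. Let $X$ be a finite domain and let $C$ be a class of functions $X\to\{-1,1\}$ that is closed under negation ($-f\in C$ for every $f\in C$). Let $\mathrm{mc}(C)$ denote its margin complexity: the least $M\ge 0$ such that for some $d$ there is a map $\Psi:X\to B^d(1)$ into the Euclidean unit ball of $\mathbb R^d$ with the property that every $f\in C$ admits $w\in B^d(1)$ with $\min_{x\in X} f(x)\langle w,\Psi(x)\rangle\ge 1/M$. Consider (randomized, possibly interactive) algorithms that access a dataset $S=(z_1,\dots,z_n)$ of labeled points $z_i=(x_i,y_i)\in X\times\{-1,1\}$ only through the oracle $\mathrm{COMM}_S$, which, given an index $i$ and a randomized map $R:X\times\{-1,1\}\to\{0,1\}^k$, returns a fresh random value of $R(z_i)$. The algorithm is $\ell$-bit communication bounded if for every $i$ the total number of bits $k$ over all its invocations on index $i$ is at most $\ell$. It is label-non-adaptive if the interrogation of a sample may depend on the oracle's answers only when it is label-independent: once the algorithm's random bits are fixed, for every index $i$, either the sequence of queries made to sample $i$ is the same for all answers of the oracle, or all queries made to sample $i$ are label-independent (the distribution of $R(x,y)$ does not depend on $y$). (If each sample is queried at most once,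 this says that every query that depends on the oracle's answers is label-independent.) Let $\mathcal A$ be a label-non-adaptive $\ell$-bit communication bounded algorithm that PAC learns $C$ with error less than $1/2$ and success probability at least $3/4$, i.e. for every distribution $D$ on $X$ and every $f\in C$, when the $n$ samples are drawn i.i.d. as $(x,f(x))$ with $x\sim D$, the algorithm outputs, with probability at least $3/4$, a function $h:X\to\{-1,1\}$ with $\Pr_{x\sim D}[f(x)\neq h(x)]<1/2$. Then $$ n\;\ge\; c\cdot\frac{\mathrm{mc}(C)^{2/3}}{2^{\ell}} .$$ -/

import Mathlib

/-- An algorithm that extracts finitely many bits from a data point: a randomized map from `Z` to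
`{0,1}^bits`, given by its output distribution on each point. -/
structure CommQuery (Z : Type*) where
  /-- the number of extracted bits -/
  bits : ℕ
  /-- the output distribution on each data point -/
  run : Z → PMF (Fin bits → Bool)

/-- An adaptive algorithm (with its own random bits already fixed) that accesses a dataset
`S ∈ Z^n` only through the oracle `COMM_S`: it either stops with an output, or invokes the oracle
on an index `i` and a bit-extracting algorithm `q`, and continues depending on the answer. -/
inductive CommProtocol (Z : Type*) (n : ℕ) (α : Type*)
  | output (a : α) : CommProtocol Z n α
  | query (i : Fin n) (q : CommQuery Z)
      (next : (Fin q.bits → Bool) → CommProtocol Z n α) : CommProtocol Z n α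

namespace CommProtocol

variable {Z : Type*} {n : ℕ} {α : Type*}

/-- The output distribution on the dataset `S`. Every invocation of the oracle uses fresh
randomness. -/
noncomputable def law : CommProtocol Z n α → (Fin n → Z) → PMF α
  | output a, _ => PMF.pure a
  | query i q next, S => (q.run (S i)).bind fun w => (next w).law S

/-- The set of all sequences of queries that sample `i` can receive, over all possible answers of
the oracle. -/
def queriesTo (i : Fin n) : CommProtocol Z n α → Set (List (CommQuery Z))
  | output _ => {[]}
  | query j q next =>
      ⋃ w, if j = i then List.cons q '' (next w).queriesTo i else (next w).queriesTo i

/-- In every execution, the total number of bits extracted from each single sample is at most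
`ℓ`. -/
def IsCommBounded (ℓ : ℕ) (T : CommProtocol Z n α) : Prop :=
  ∀ i, ∀ L ∈ T.queriesTo i, (L.map CommQuery.bits).sum ≤ ℓ

end CommProtocol

/-- A query on labeled points `(x, y)` is label-independent if it depends only on the point `x`. -/
def CommQuery.LabelIndependent {X : Type*} (q : CommQuery (X × ℤˣ)) : Prop :=
  ∀ x y y', q.run (x, y) = q.run (x, y')

/-- Label-non-adaptivity: the interrogation of a sample may depend on the oracle's answers only if
it is label-independent. That is, for every sample `i`, either the sequence of queries
to `i` is the same for all answers of the oracle, or all queries to `i` are label-independent. -/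
def CommProtocol.LabelNonAdaptive {X : Type*} {n : ℕ} {α : Type*}
    (T : CommProtocol (X × ℤˣ) n α) : Prop :=
  ∀ i, (T.queriesTo i).Subsingleton ∨ ∀ L ∈ T.queriesTo i, ∀ q ∈ L, q.LabelIndependent

/-- The distribution `P^n` of a dataset of `n` independent samples from `P`. -/
noncomputable def iidPMF {Z : Type*} (P : PMF Z) : (n : ℕ) → PMF (Fin n → Z)
  | 0 => PMF.pure Fin.elim0
  | n + 1 => P.bind fun z => (iidPMF P n).map fun S => Fin.cons (α := fun _ => Z) z S

theorem iidPMF_apply {Z : Type*} (P : PMF Z) (n : ℕ) (S : Fin n → Z) :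
    iidPMF P n S = ∏ i, P (S i) := by
  classical
  induction n with
  | zero => simp [iidPMF, Subsingleton.elim S Fin.elim0]
  | succ n ih =>
    have key : ∀ z, ((iidPMF P n).map fun S => Fin.cons (α := fun _ => Z) z S) S
        = if z = S 0 then iidPMF P n (Fin.tail S) else 0 := by
      intro z
      rw [PMF.map_apply]
      split_ifs with h
      · subst h
        rw [tsum_eq_single (Fin.tail S)]
        · simp
        · intro b hb
          rw [if_neg]
          intro h
          exact hb (by rw [h]; simp)
      · rw [ENNReal.tsum_eq_zero]
        intro b
        rw [if_neg]
        intro h'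
        exact h (by rw [h']; simp)
    simp only [iidPMF, PMF.bind_apply, key]
    rw [tsum_eq_single (S 0)]
    · simp [ih, Fin.prod_univ_succ, Fin.tail]
    · intro b hb
      simp [hb]

/-- A randomized algorithm with access to `COMM_S` for labeled samples and outputting a
`±1`-valued hypothesis: a distribution (of the algorithm's own random bits) over protocols. -/
abbrev CommLearner (X : Type*) (n : ℕ) := PMF (CommProtocol (X × ℤˣ) n (X → ℤˣ))

namespace CommLearner

variable {X : Type*} {n : ℕ}

/-- The distribution of the hypothesis, when the `n` samples are drawn i.i.d. as `(x, f x)` with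
`x` distributed according to `D`. -/
noncomputable def hypothesisLaw (A : CommLearner X n) (D : PMF X) (f : X → ℤˣ) :
    PMF (X → ℤˣ) :=
  A.bind fun T => (iidPMF (D.map fun x => (x, f x)) n).bind fun S => T.law S

/-- The learner is `ℓ`-bit communication bounded. -/
def IsCommBounded (ℓ : ℕ) (A : CommLearner X n) : Prop :=
  ∀ T ∈ A.support, T.IsCommBounded ℓ

/-- The learner is label-non-adaptive: queries may depend on its random bits, but label-dependent
ones not on the answers of the oracle. -/
def LabelNonAdaptive (A : CommLearner X n) : Prop :=
  ∀ T ∈ A.support, T.LabelNonAdaptive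

/-- Distribution-independent PAC learning of `C` with error less than `1/2` and success probability
at least `p`. -/
def WeakPACLearns (A : CommLearner X n) (C : Set (X → ℤˣ)) (p : ENNReal) : Prop :=
  ∀ D : PMF X, ∀ f ∈ C,
    p ≤ (A.hypothesisLaw D f).toOuterMeasure
      {h | D.toOuterMeasure {x | f x ≠ h x} < 1 / 2}

end CommLearner

/-- The margin complexity of a class `C` of `±1`-valued functions on `X`: the least `M` such that,
for some `d`, there is a map `Ψ` of `X` to the unit ball of `ℝ^d` such that every `f ∈ C` is
separated by some `w` in the unit ball with margin at least `1 / M`. -/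
noncomputable def marginComplexity {X : Type*} (C : Set (X → ℤˣ)) : ℝ :=
  sInf {M : ℝ | 0 < M ∧ ∃ (d : ℕ) (Ψ : X → EuclideanSpace ℝ (Fin d)), (∀ x, ‖Ψ x‖ ≤ 1) ∧
    ∀ f ∈ C, ∃ w : EuclideanSpace ℝ (Fin d), ‖w‖ ≤ 1 ∧
      ∀ x, 1 / M ≤ (((f x : ℤˣ) : ℤ) : ℝ) * inner ℝ w (Ψ x)}

/-! A hypothesis cannot have error below 1/2 for both `f` and `-f`, so a learner for both must react
when all labels are flipped: the two success probabilities sum to at least 3/2, but would sum to at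
most 1 without a reaction.

Flip the samples one at a time (`abs_sum_prod_sub_sum_prod_le`). A sample with label-independent
queries contributes nothing. One with a fixed list of queries influences the output only through its
at most 2^ℓ possible answers `w`, and contributes at most the sum over `w` of |E_D[f b_w]|, where
the bias b_w(x) is the change of the probability of `w` under a flip of the label of x. This is
`abs_prob_sub_prob_neg_le`, the only place where label-non-adaptivity enters.

With N = n 2^ℓ terms in all, the expected sum of the squares E_D[f b_w]² is therefore at least
1/(4N), for every D. It is the quadratic form, at D·f, of the positive semidefinite kernel K(x,y) =
E Σ b_w(x) b_w(y), which depends neither on `f` nor on D and has diagonal at most 2n. Gram vectors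
of K thus give one embedding for all of C, and the minimal-norm point of a convex hull turns
correlation under every D into a margin (`exists_inner_ge_of_norm_sum_ge`). -/

/-! ### Probabilities of events under a `PMF`, as real numbers -/

namespace PMF

variable {α β : Type*}

/-- The probability of an event, as a real number. -/
noncomputable def prob (μ : PMF α) (E : Set α) : ℝ := (μ.toOuterMeasure E).toReal

theorem toOuterMeasure_le_one (μ : PMF α) (E : Set α) : μ.toOuterMeasure E ≤ 1 :=
  (μ.toOuterMeasure.mono (Set.subset_univ E)).trans
    ((μ.toOuterMeasure_apply_eq_one_iff Set.univ).2 (Set.subset_univ _)).le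

theorem prob_nonneg (μ : PMF α) (E : Set α) : 0 ≤ μ.prob E := ENNReal.toReal_nonneg

theorem prob_le_one (μ : PMF α) (E : Set α) : μ.prob E ≤ 1 :=
  ENNReal.toReal_mono ENNReal.one_ne_top (μ.toOuterMeasure_le_one E)

theorem toOuterMeasure_add_le_one (μ : PMF α) {E F : Set α} (h : Disjoint E F) :
    μ.toOuterMeasure E + μ.toOuterMeasure F ≤ 1 := by
  rw [toOuterMeasure_apply, toOuterMeasure_apply, ← ENNReal.tsum_add, ← μ.tsum_coe]
  refine ENNReal.tsum_le_tsum fun a => ?_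
  by_cases ha : a ∈ E
  · simp [ha, Set.disjoint_left.1 h ha]
  · simpa [ha] using Set.indicator_le_self' (fun _ _ => zero_le) a

theorem prob_add_le_one (μ : PMF α) {E F : Set α} (h : Disjoint E F) :
    μ.prob E + μ.prob F ≤ 1 := by
  have hE := (μ.toOuterMeasure_le_one E).trans_lt ENNReal.one_lt_top
  have hF := (μ.toOuterMeasure_le_one F).trans_lt ENNReal.one_lt_top
  rw [prob, prob, ← ENNReal.toReal_add hE.ne hF.ne]
  exact ENNReal.toReal_mono ENNReal.one_ne_top (μ.toOuterMeasure_add_le_one h)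

theorem prob_bind (μ : PMF α) (g : α → PMF β) (E : Set β) :
    (μ.bind g).prob E = ∑' a, (μ a).toReal * (g a).prob E := by
  rw [prob, toOuterMeasure_bind_apply, ENNReal.tsum_toReal_eq]
  · simp [prob, ENNReal.toReal_mul]
  · exact fun a => ENNReal.mul_ne_top (μ.apply_ne_top a)
      ((toOuterMeasure_le_one _ _).trans_lt ENNReal.one_lt_top).ne

theorem summable_toReal (μ : PMF α) : Summable fun a => (μ a).toReal :=
  ENNReal.summable_toReal μ.tsum_coe_ne_top

theorem tsum_toReal (μ : PMF α) : ∑' a, (μ a).toReal = 1 := by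
  rw [← ENNReal.tsum_toReal_eq μ.apply_ne_top, μ.tsum_coe, ENNReal.toReal_one]

theorem toReal_le_one (μ : PMF α) (a : α) : (μ a).toReal ≤ 1 :=
  ENNReal.toReal_mono ENNReal.one_ne_top (μ.coe_le_one a)

theorem sum_toReal [Fintype α] (μ : PMF α) : ∑ a, (μ a).toReal = 1 := by
  rw [← tsum_fintype (L := .unconditional α), μ.tsum_toReal]

theorem prob_bind_fintype [Fintype α] (μ : PMF α) (g : α → PMF β) (E : Set β) :
    (μ.bind g).prob E = ∑ a, (μ a).toReal * (g a).prob E := by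
  rw [prob_bind, tsum_fintype]

/-- The expectation of a bounded function is summable. -/
theorem summable_toReal_mul (μ : PMF α) {g : α → ℝ} {B : ℝ}
    (hg : ∀ a ∈ μ.support, |g a| ≤ B) : Summable fun a => (μ a).toReal * g a := by
  refine Summable.of_norm_bounded (g := fun a => (μ a).toReal * B)
    (μ.summable_toReal.mul_right B) fun a => ?_
  rw [Real.norm_eq_abs, abs_mul, abs_of_nonneg ENNReal.toReal_nonneg]
  by_cases ha : a ∈ μ.support
  · exact mul_le_mul_of_nonneg_left (hg a ha) ENNReal.toReal_nonneg
  · simp [(μ.apply_eq_zero_iff a).2 ha]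

theorem sum_map_toReal_mul [Fintype α] [Fintype β] (μ : PMF α) (e : α → β) (g : β → ℝ) :
    ∑ b, ((μ.map e) b).toReal * g b = ∑ a, (μ a).toReal * g (e a) := by
  classical
  have h : ∀ b, ((μ.map e) b).toReal = ∑ a, if b = e a then (μ a).toReal else 0 := by
    intro b
    rw [map_apply, tsum_fintype, ENNReal.toReal_sum]
    · exact Finset.sum_congr rfl fun a _ => by split_ifs <;> simp
    · intro a _
      split_ifs
      · exact μ.apply_ne_top a
      · simp
  simp_rw [h, Finset.sum_mul]
  rw [Finset.sum_comm]
  simp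

end PMF

/-! ### Changing the factors of a product distribution one by one -/

/-- If changing the distribution of any single coordinate from `p` to `q` changes the expectation
of `g` by at most `δ i`, whatever the other coordinates are, then changing all coordinates changes
it by at most `∑ i, δ i`. -/
theorem abs_sum_prod_sub_sum_prod_le {Z : Type*} [Fintype Z] {p q : Z → ℝ}
    (hp : ∀ z, 0 ≤ p z) (hp1 : ∑ z, p z = 1) (hq : ∀ z, 0 ≤ q z) (hq1 : ∑ z, q z = 1) :
    ∀ {n : ℕ} (g : (Fin n → Z) → ℝ) (δ : Fin n → ℝ),
      (∀ i S, |∑ z, (p z - q z) * g (Function.update S i z)| ≤ δ i) →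
      |∑ S : Fin n → Z, (∏ i, p (S i)) * g S - ∑ S : Fin n → Z, (∏ i, q (S i)) * g S| ≤
        ∑ i, δ i
  | 0, g, δ, _ => by simp
  | n + 1, g, δ, h => by
    have key : ∀ r : Z → ℝ, ∑ S : Fin (n + 1) → Z, (∏ i, r (S i)) * g S =
        ∑ z, r z * ∑ S : Fin n → Z, (∏ i, r (S i)) * g (Fin.cons z S) := by
      intro r
      rw [← (Fin.consEquiv fun _ : Fin (n + 1) => Z).sum_comp, Fintype.sum_prod_type]
      refine Finset.sum_congr rfl fun z _ => ?_
      rw [Finset.mul_sum]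
      refine Finset.sum_congr rfl fun S _ => ?_
      simp [Fin.consEquiv, Fin.prod_univ_succ, mul_assoc]
    have hq1' : ∑ S : Fin n → Z, ∏ i, q (S i) = 1 := by
      rw [← Fintype.prod_sum]
      simp [hq1]
    -- Hybrid: the tail is changed while the head still follows `p`, then the head is changed with
    -- the tail already following `q`.
    have split : ∑ S : Fin (n + 1) → Z, (∏ i, p (S i)) * g S -
          ∑ S : Fin (n + 1) → Z, (∏ i, q (S i)) * g S =
        ∑ z, p z * (∑ S : Fin n → Z, (∏ i, p (S i)) * g (Fin.cons z S) -
          ∑ S : Fin n → Z, (∏ i, q (S i)) * g (Fin.cons z S)) +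
        ∑ S : Fin n → Z, (∏ i, q (S i)) * ∑ z, (p z - q z) * g (Fin.cons z S) := by
      have hcomm : ∑ S : Fin n → Z, (∏ i, q (S i)) * ∑ z, (p z - q z) * g (Fin.cons z S) =
          ∑ z, (p z - q z) * ∑ S : Fin n → Z, (∏ i, q (S i)) * g (Fin.cons z S) := by
        simp_rw [Finset.mul_sum]
        rw [Finset.sum_comm]
        exact Finset.sum_congr rfl fun z _ => Finset.sum_congr rfl fun S _ => by ring
      rw [hcomm, key p, key q, ← Finset.sum_add_distrib, ← Finset.sum_sub_distrib]
      exact Finset.sum_congr rfl fun z _ => by ring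
    rw [split, Fin.sum_univ_succ, add_comm (δ 0)]
    refine (abs_add_le _ _).trans (add_le_add ?_ ?_)
    · calc |∑ z, p z * (∑ S : Fin n → Z, (∏ i, p (S i)) * g (Fin.cons z S) -
            ∑ S : Fin n → Z, (∏ i, q (S i)) * g (Fin.cons z S))|
          ≤ ∑ z, p z * ∑ i : Fin n, δ i.succ := by
            refine (Finset.abs_sum_le_sum_abs _ _).trans (Finset.sum_le_sum fun z _ => ?_)
            rw [abs_mul, abs_of_nonneg (hp z)]
            refine mul_le_mul_of_nonneg_left ?_ (hp z)
            refine abs_sum_prod_sub_sum_prod_le hp hp1 hq hq1 (fun S => g (Fin.cons z S))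
              (fun i => δ i.succ) fun i S => ?_
            simpa [Fin.cons_update] using h i.succ (Fin.cons z S)
        _ = ∑ i : Fin n, δ i.succ := by rw [← Finset.sum_mul, hp1, one_mul]
    · calc |∑ S : Fin n → Z, (∏ i, q (S i)) * ∑ z, (p z - q z) * g (Fin.cons z S)|
          ≤ ∑ S : Fin n → Z, (∏ i, q (S i)) * δ 0 := by
            refine (Finset.abs_sum_le_sum_abs _ _).trans (Finset.sum_le_sum fun S _ => ?_)
            have hS : 0 ≤ ∏ i, q (S i) := Finset.prod_nonneg fun i _ => hq _
            rw [abs_mul, abs_of_nonneg hS]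
            refine mul_le_mul_of_nonneg_left ?_ hS
            -- The head `z₀` is arbitrary, as the update overwrites it.
            obtain hZ | ⟨⟨z₀⟩⟩ := isEmpty_or_nonempty Z
            · simp at hq1
            · simpa [Fin.update_cons_zero] using h 0 (Fin.cons z₀ S)
        _ = δ 0 := by rw [← Finset.sum_mul, hq1', one_mul]

/-! ### Margins from correlations -/

/-- If all convex combinations of finitely many vectors have norm at least `γ`, then some vector of
the unit ball has inner product at least `γ` with each of them. -/
theorem exists_inner_ge_of_norm_sum_ge {E X : Type*} [NormedAddCommGroup E] [InnerProductSpace ℝ E]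
    [Fintype X] [Nonempty X] (v : X → E) {γ : ℝ} (hγ : 0 < γ)
    (h : ∀ D : X → ℝ, (∀ x, 0 ≤ D x) → ∑ x, D x = 1 → γ ≤ ‖∑ x, D x • v x‖) :
    ∃ w : E, ‖w‖ ≤ 1 ∧ ∀ x, γ ≤ inner ℝ w (v x) := by
  classical
  set T : (X → ℝ) →ₗ[ℝ] E := Fintype.linearCombination ℝ v with hT
  have hTa : ∀ D, T D = ∑ x, D x • v x := fun D => Fintype.linearCombination_apply ..
  have hcont : Continuous T := by
    have : (T : (X → ℝ) → E) = fun D => ∑ x, D x • v x := funext hTa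
    rw [this]; fun_prop
  set K : Set E := T '' stdSimplex ℝ X with hK
  have hconv : Convex ℝ K := (convex_stdSimplex ℝ X).linear_image T
  have hcomp : IsComplete K := ((isCompact_stdSimplex ℝ X).image hcont).isComplete
  have hmem : ∀ x, v x ∈ K := fun x =>
    ⟨Pi.single x 1, single_mem_stdSimplex ℝ x, by simp [hTa, Pi.single_apply, ite_smul]⟩
  -- For the point `p` of `K` nearest to 0, the variational inequality says ⟨p, v x⟩ ≥ ‖p‖², so the
  -- direction of `p` has margin ‖p‖ ≥ γ.
  obtain ⟨p, hp, hmin⟩ := exists_norm_eq_iInf_of_complete_convex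
    ⟨_, hmem (Classical.arbitrary X)⟩ hcomp hconv 0
  have hle := (norm_eq_iInf_iff_real_inner_le_zero hconv hp).1 hmin
  have hpγ : γ ≤ ‖p‖ := by
    obtain ⟨D, hD, rfl⟩ := hp
    rw [hTa]
    exact h D hD.1 hD.2
  have hp0 : 0 < ‖p‖ := hγ.trans_le hpγ
  refine ⟨‖p‖⁻¹ • p, by simp [norm_smul, hp0.ne'], fun x => ?_⟩
  have hx := hle (v x) (hmem x)
  rw [zero_sub, inner_neg_left, inner_sub_right, real_inner_self_eq_norm_sq] at hx
  rw [real_inner_smul_left]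
  refine hpγ.trans ?_
  rw [inv_mul_eq_div, le_div_iff₀ hp0]
  nlinarith

/-- A kernel with diagonal at most `B`, all of whose sign patterns in `C` have correlation at least
`a` under each distribution, bounds the margin complexity of `C`. -/
theorem marginComplexity_le_of_posSemidef {X : Type*} [Fintype X] [Nonempty X]
    (C : Set (X → ℤˣ)) (K : Matrix X X ℝ) (hK : K.PosSemidef) {a B M : ℝ} (hM : 0 < M)
    (hB : 0 < B) (hMa : B ≤ a * M ^ 2) (hdiag : ∀ x, K x x ≤ B)
    (hcorr : ∀ f ∈ C, ∀ D : X → ℝ, (∀ x, 0 ≤ D x) → ∑ x, D x = 1 →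
      a ≤ ∑ x, ∑ y, (D x * ((f x : ℤˣ) : ℤ)) * (D y * ((f y : ℤˣ) : ℤ)) * K x y) :
    marginComplexity C ≤ M := by
  obtain ⟨d, v, hv⟩ := Matrix.posSemidef_iff_eq_sum_vecMulVec.1 hK
  have hKv : ∀ x y, K x y = ∑ k, v k x * v k y := by
    intro x y
    rw [hv, Matrix.sum_apply]
    simp [Matrix.vecMulVec_apply]
  -- This scaling puts the Gram vectors into the unit ball and turns the correlation a into a/B ≥
  -- 1/M².
  set s : ℝ := (Real.sqrt B)⁻¹ with hs
  have hsB : s ^ 2 * B = 1 := by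
    rw [hs, inv_pow, Real.sq_sqrt hB.le, inv_mul_cancel₀ hB.ne']
  refine csInf_le ⟨0, fun M hM => hM.1.le⟩ ⟨hM, d,
    fun x => WithLp.toLp 2 fun k => s * v k x, fun x => ?_, fun f hf => ?_⟩
  · rw [← sq_le_one_iff₀ (norm_nonneg _), EuclideanSpace.norm_sq_eq]
    calc ∑ k, ‖s * v k x‖ ^ 2 = s ^ 2 * K x x := by
          rw [hKv, Finset.mul_sum]
          exact Finset.sum_congr rfl fun k _ => by rw [Real.norm_eq_abs, sq_abs]; ring
      _ ≤ s ^ 2 * B := mul_le_mul_of_nonneg_left (hdiag x) (sq_nonneg s)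
      _ = 1 := hsB
  · obtain ⟨w, hw, hwx⟩ := exists_inner_ge_of_norm_sum_ge (γ := 1 / M)
      (fun x => (((f x : ℤˣ) : ℤ) : ℝ) •
        (WithLp.toLp 2 fun k => s * v k x : EuclideanSpace ℝ (Fin d)))
      (by positivity) fun D hD hD1 => by
        refine le_of_sq_le_sq ?_ (norm_nonneg _)
        rw [EuclideanSpace.norm_sq_eq]
        have h := hcorr f hf D hD hD1
        have hsum : ∑ k, ‖(∑ x, D x • (((f x : ℤˣ) : ℤ) : ℝ) •
            (WithLp.toLp 2 fun k => s * v k x : EuclideanSpace ℝ (Fin d))) k‖ ^ 2 = s ^ 2 *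
            ∑ x, ∑ y, (D x * ((f x : ℤˣ) : ℤ)) * (D y * ((f y : ℤˣ) : ℤ)) * K x y := by
          simp_rw [hKv, Finset.mul_sum]
          have hcomm : ∀ F : X → X → Fin d → ℝ,
              ∑ x, ∑ y, ∑ k, F x y k = ∑ k, ∑ x, ∑ y, F x y k := fun F => by
            rw [Finset.sum_comm]
            simp_rw [Finset.sum_comm (s := (Finset.univ : Finset (Fin d)))]
            rw [Finset.sum_comm]
          rw [hcomm]
          refine Finset.sum_congr rfl fun k _ => ?_
          rw [Real.norm_eq_abs, sq_abs, sq]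
          simp only [WithLp.ofLp_sum, WithLp.ofLp_smul, Finset.sum_apply, Pi.smul_apply,
            smul_eq_mul]
          rw [Finset.sum_mul_sum]
          exact Finset.sum_congr rfl fun x _ => Finset.sum_congr rfl fun y _ => by ring
        rw [hsum]
        calc (1 / M) ^ 2 = s ^ 2 * (B / M ^ 2) := by
              rw [mul_div_assoc', hsB, div_pow, one_pow]
          _ ≤ s ^ 2 * a :=
              mul_le_mul_of_nonneg_left ((div_le_iff₀ (by positivity)).2 hMa) (sq_nonneg s)
          _ ≤ _ := mul_le_mul_of_nonneg_left h (sq_nonneg s)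
    exact ⟨w, hw, fun x => by simpa only [real_inner_smul_right] using hwx x⟩

/-! ### Transcripts of a fixed sequence of queries -/

namespace CommQuery

variable {Z : Type*}

/-- The possible answers to a sequence of queries. -/
def Answers : List (CommQuery Z) → Type
  | [] => Unit
  | q :: L => (Fin q.bits → Bool) × Answers L

instance Answers.fintype : ∀ L : List (CommQuery Z), Fintype (Answers L)
  | [] => inferInstanceAs (Fintype Unit)
  | q :: L =>
    letI := Answers.fintype L
    inferInstanceAs (Fintype ((Fin q.bits → Bool) × Answers L))

theorem card_answers : ∀ L : List (CommQuery Z),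
    Fintype.card (Answers L) = 2 ^ (L.map CommQuery.bits).sum
  | [] => rfl
  | q :: L => by
    rw [List.map_cons, List.sum_cons, pow_add, ← card_answers L]
    refine (Fintype.card_prod (Fin q.bits → Bool) (Answers L)).trans ?_
    simp

/-- The distribution of the answers to a fixed sequence of queries to one data point. -/
noncomputable def answersLaw : (L : List (CommQuery Z)) → Z → PMF (Answers L)
  | [], _ => PMF.pure ()
  | q :: L, z => (q.run z).bind fun w => (answersLaw L z).map fun v => (w, v)

/-- How much the probability of the answers `w` depends on the label of the point `x`. -/
noncomputable def labelBias {X : Type*} (L : List (CommQuery (X × ℤˣ))) (w : Answers L) (x : X) :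
    ℝ :=
  (answersLaw L (x, 1) w).toReal - (answersLaw L (x, -1) w).toReal

theorem labelBias_mul {X : Type*} (L : List (CommQuery (X × ℤˣ))) (w : Answers L) (x : X)
    (y : ℤˣ) : labelBias L w x * ((y : ℤ) : ℝ) =
      (answersLaw L (x, y) w).toReal - (answersLaw L (x, -y) w).toReal := by
  obtain rfl | rfl := Int.units_eq_one_or y <;> simp [labelBias]

/-- For p, q in [0, 1], (p - q)² ≤ p + q, and each answer law has mass 1. The bound is free of the
number of answers, which keeps the kernel's diagonal free of 2^ℓ. -/
theorem sum_sq_labelBias_le {X : Type*} (L : List (CommQuery (X × ℤˣ))) (x : X) :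
    ∑ w, labelBias L w x ^ 2 ≤ 2 := by
  have h : ∀ w, labelBias L w x ^ 2 ≤
      (answersLaw L (x, 1) w).toReal + (answersLaw L (x, -1) w).toReal := by
    intro w
    have h1 := (answersLaw L (x, 1)).toReal_le_one w
    have h2 := (answersLaw L (x, -1)).toReal_le_one w
    have h3 : 0 ≤ (answersLaw L (x, 1) w).toReal := ENNReal.toReal_nonneg
    have h4 : 0 ≤ (answersLaw L (x, -1) w).toReal := ENNReal.toReal_nonneg
    rw [labelBias]
    nlinarith [mul_nonneg h3 h4]
  refine (Finset.sum_le_sum fun w _ => h w).trans ?_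
  rw [Finset.sum_add_distrib, PMF.sum_toReal, PMF.sum_toReal]
  norm_num

end CommQuery

/-! ### The dependence of a protocol on a single sample -/

namespace CommProtocol

open CommQuery

variable {Z : Type*} {n : ℕ} {α : Type*}

theorem queriesTo_nonempty (i : Fin n) (T : CommProtocol Z n α) : (T.queriesTo i).Nonempty := by
  induction T with
  | output a => exact ⟨[], rfl⟩
  | query j q next ih =>
    obtain ⟨L, hL⟩ := ih fun _ => false
    rw [queriesTo]
    by_cases h : j = i
    · exact ⟨q :: L, Set.mem_iUnion.2 ⟨fun _ => false, by
        rw [if_pos h]; exact ⟨L, hL, rfl⟩⟩⟩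
    · exact ⟨L, Set.mem_iUnion.2 ⟨fun _ => false, by rwa [if_neg h]⟩⟩

/-- If the queries to sample `i` do not depend on the answers, the output is a randomized function
of the answers to these queries and the other samples. -/
theorem exists_law_update_eq_bind (i : Fin n) (S : Fin n → Z) (T : CommProtocol Z n α)
    (L : List (CommQuery Z)) (h : T.queriesTo i = {L}) :
    ∃ κ : Answers L → PMF α, ∀ z, T.law (Function.update S i z) = (answersLaw L z).bind κ := by
  induction T generalizing L with
  | output a =>
    obtain rfl : L = [] := by
      rw [queriesTo] at h
      exact (Set.singleton_eq_singleton_iff.1 h).symm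
    exact ⟨fun _ => PMF.pure a, fun z => by rw [law, PMF.bind_const]⟩
  | query j q next ih =>
    rw [queriesTo] at h
    have hsub := fun w => (Set.subset_iUnion _ w).trans h.subset
    by_cases hji : j = i
    · subst hji
      simp only [if_true, Set.image_subset_iff] at hsub
      -- All continuations must produce the same remaining list, so one `L'` serves for every answer
      -- `w`.
      obtain ⟨L', hL'⟩ := queriesTo_nonempty j (next fun _ => false)
      obtain rfl : q :: L' = L := hsub _ hL'
      have hw : ∀ w, (next w).queriesTo j = {L'} := fun w =>
        (queriesTo_nonempty j (next w)).subset_singleton_iff.1 fun L₁ hL₁ =>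
          (List.cons.inj (hsub w hL₁)).2
      choose κ hκ using fun w => ih w L' (hw w)
      refine ⟨fun v => κ v.1 v.2, fun z => ?_⟩
      rw [law, answersLaw, PMF.bind_bind, Function.update_self]
      congr 1
      ext1 w
      rw [hκ]
      exact (PMF.bind_map (answersLaw L' z) (fun v => (w, v)) fun v => κ v.1 v.2).symm
    · simp only [if_neg hji] at hsub
      choose κ hκ using fun w => ih w L
        ((queriesTo_nonempty i (next w)).subset_singleton_iff.1 (hsub w))
      -- The answer of another sample does not involve `z`, so its randomness commutes past the
      -- answers of sample `i` and is absorbed into the kernel.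
      refine ⟨fun v => (q.run (S j)).bind fun w => κ w v, fun z => ?_⟩
      rw [law, PMF.bind_comm, Function.update_of_ne hji]
      simp_rw [hκ]

/-- Adaptivity is harmless here: each answer has the same law for both labels, hence so does
everything chosen from the answers. -/
theorem law_update_eq_of_labelIndependent {X : Type*} (i : Fin n) (S : Fin n → X × ℤˣ)
    (T : CommProtocol (X × ℤˣ) n α) (h : ∀ L ∈ T.queriesTo i, ∀ q ∈ L, q.LabelIndependent)
    (x : X) (y y' : ℤˣ) :
    T.law (Function.update S i (x, y)) = T.law (Function.update S i (x, y')) := by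
  induction T with
  | output a => rfl
  | query j q next ih =>
    rw [queriesTo] at h
    have hnext : ∀ w, (next w).law (Function.update S i (x, y)) =
        (next w).law (Function.update S i (x, y')) := by
      refine fun w => ih w fun L hL q' hq' => ?_
      by_cases hji : j = i
      · exact h (q :: L) (Set.mem_iUnion.2 ⟨w, by rw [if_pos hji]; exact ⟨L, hL, rfl⟩⟩) q'
          (List.mem_cons_of_mem q hq')
      · exact h L (Set.mem_iUnion.2 ⟨w, by rwa [if_neg hji]⟩) q' hq'
    rw [law, law]
    simp_rw [hnext]
    by_cases hji : j = i
    · subst hji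
      obtain ⟨L, hL⟩ := queriesTo_nonempty j (next fun _ => false)
      have hq := h (q :: L)
        (Set.mem_iUnion.2 ⟨fun _ => false, by rw [if_pos rfl]; exact ⟨L, hL, rfl⟩⟩) q
        List.mem_cons_self
      rw [Function.update_self, Function.update_self, hq x y y']
    · rw [Function.update_of_ne hji, Function.update_of_ne hji]

open Classical in
/-- The sequence of queries to sample `i` when it does not depend on the answers, and the empty
sequence otherwise. -/
noncomputable def fixedQueries (T : CommProtocol Z n α) (i : Fin n) : List (CommQuery Z) :=
  -- The default `[]` has a single answer, whose bias is zero, so such a sample adds nothing to the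
  -- kernel and respects the count 2^ℓ.
  if h : ∃ L, T.queriesTo i = {L} then h.choose else []

theorem queriesTo_eq_fixedQueries {T : CommProtocol Z n α} {i : Fin n}
    (h : (T.queriesTo i).Subsingleton) : T.queriesTo i = {T.fixedQueries i} := by
  obtain ⟨L, hL⟩ := queriesTo_nonempty i T
  have hex : ∃ L, T.queriesTo i = {L} := ⟨L, h.eq_singleton_of_mem hL⟩
  rw [fixedQueries, dif_pos hex]
  exact hex.choose_spec

theorem card_answers_fixedQueries_le {T : CommProtocol Z n α} {ℓ : ℕ} (hT : T.IsCommBounded ℓ)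
    (i : Fin n) : Fintype.card (Answers (T.fixedQueries i)) ≤ 2 ^ ℓ := by
  rw [card_answers]
  refine Nat.pow_le_pow_right two_pos ?_
  rw [fixedQueries]
  split_ifs with h
  · exact hT i _ (h.choose_spec.symm.subset (Set.mem_singleton _))
  · simp

/-- The bias of the answers of sample `i`. -/
noncomputable def bias {X : Type*} (T : CommProtocol (X × ℤˣ) n α) (i : Fin n)
    (w : Answers (T.fixedQueries i)) (x : X) : ℝ :=
  labelBias (T.fixedQueries i) w x

/-- Flipping all labels changes the output distribution of a label-non-adaptive protocol by at
most the total correlation of the label with the biases of the answers. -/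
theorem abs_prob_sub_prob_neg_le {X : Type*} [Fintype X] {T : CommProtocol (X × ℤˣ) n α}
    (hT : T.LabelNonAdaptive) (D : PMF X) (f : X → ℤˣ) (E : Set α) :
    |((iidPMF (D.map fun x => (x, f x)) n).bind fun S => T.law S).prob E -
      ((iidPMF (D.map fun x => (x, (-f) x)) n).bind fun S => T.law S).prob E| ≤
    ∑ i, ∑ w, |∑ x, (D x).toReal * ((f x : ℤˣ) : ℤ) * T.bias i w x| := by
  classical
  rw [PMF.prob_bind_fintype, PMF.prob_bind_fintype]
  simp_rw [iidPMF_apply, ENNReal.toReal_prod]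
  refine abs_sum_prod_sub_sum_prod_le (fun _ => ENNReal.toReal_nonneg) (PMF.sum_toReal _)
    (fun _ => ENNReal.toReal_nonneg) (PMF.sum_toReal _) (fun S => (T.law S).prob E) _
    fun i S => ?_
  simp_rw [sub_mul]
  rw [Finset.sum_sub_distrib,
    PMF.sum_map_toReal_mul D (fun x => (x, f x)) fun z => (T.law (Function.update S i z)).prob E,
    PMF.sum_map_toReal_mul D (fun x => (x, (-f) x))
      fun z => (T.law (Function.update S i z)).prob E]
  obtain h | h := hT i
  · obtain ⟨κ, hκ⟩ := exists_law_update_eq_bind i S T _ (queriesTo_eq_fixedQueries h)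
    simp_rw [hκ, PMF.prob_bind_fintype]
    have heq : ∑ x, (D x).toReal * ∑ w, ((answersLaw (T.fixedQueries i) (x, f x)) w).toReal *
          (κ w).prob E - ∑ x, (D x).toReal *
          ∑ w, ((answersLaw (T.fixedQueries i) (x, (-f) x)) w).toReal * (κ w).prob E =
        ∑ w, (∑ x, (D x).toReal * ((f x : ℤˣ) : ℤ) * T.bias i w x) * (κ w).prob E := by
      simp_rw [Finset.mul_sum, Finset.sum_mul]
      rw [Finset.sum_comm (s := (Finset.univ : Finset (Answers (T.fixedQueries i)))),
        ← Finset.sum_sub_distrib]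
      refine Finset.sum_congr rfl fun x _ => ?_
      rw [← Finset.sum_sub_distrib]
      refine Finset.sum_congr rfl fun w _ => ?_
      rw [bias, mul_assoc (D x).toReal, mul_comm (((f x : ℤˣ) : ℤ) : ℝ), labelBias_mul,
        Pi.neg_apply]
      ring
    rw [heq]
    refine (Finset.abs_sum_le_sum_abs _ _).trans (Finset.sum_le_sum fun w _ => ?_)
    rw [abs_mul, abs_of_nonneg (PMF.prob_nonneg _ _)]
    exact mul_le_of_le_one_right (abs_nonneg _) (PMF.prob_le_one _ _)
  · have heq : ∀ x, T.law (Function.update S i (x, (-f) x)) =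
        T.law (Function.update S i (x, f x)) := fun x =>
      law_update_eq_of_labelIndependent i S T h x _ _
    simp_rw [heq, sub_self, abs_zero]
    exact Finset.sum_nonneg fun w _ => abs_nonneg _

end CommProtocol

/-! ### ### The kernel of a learner and its correlation with the class -/

namespace CommLearner

open CommProtocol CommQuery

variable {X : Type*} {n : ℕ}

/-- The expected correlation kernel of the biases of the answers. -/
noncomputable def biasKernel (A : CommLearner X n) : Matrix X X ℝ := fun x y =>
  ∑' T, (A T).toReal * ∑ i, ∑ w, T.bias i w x * T.bias i w y

theorem sum_bias_sq_le (T : CommProtocol (X × ℤˣ) n (X → ℤˣ)) (x : X) :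
    ∑ i, ∑ w, T.bias i w x * T.bias i w x ≤ 2 * n := by
  refine (Finset.sum_le_sum (g := fun _ => (2 : ℝ)) fun i _ => ?_).trans_eq
    (by simp [mul_comm])
  simpa only [sq, bias] using sum_sq_labelBias_le (T.fixedQueries i) x

/-- By AM-GM from the diagonal. Being uniform in `T`, the bound makes the series defining the kernel
summable. -/
theorem abs_sum_bias_mul_le (T : CommProtocol (X × ℤˣ) n (X → ℤˣ)) (x y : X) :
    |∑ i, ∑ w, T.bias i w x * T.bias i w y| ≤ 2 * n := by
  have h : 2 * |∑ i, ∑ w, T.bias i w x * T.bias i w y| ≤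
      ∑ i, ∑ w, T.bias i w x * T.bias i w x + ∑ i, ∑ w, T.bias i w y * T.bias i w y := by
    rw [show ∀ s : ℝ, 2 * |s| = |2 * s| from fun s => by rw [abs_mul, abs_two], Finset.mul_sum, ← Finset.sum_add_distrib]
    refine (Finset.abs_sum_le_sum_abs _ _).trans (Finset.sum_le_sum fun i _ => ?_)
    rw [Finset.mul_sum, ← Finset.sum_add_distrib]
    refine (Finset.abs_sum_le_sum_abs _ _).trans (Finset.sum_le_sum fun w _ => ?_)
    rw [abs_le]
    constructor <;> nlinarith [sq_nonneg (T.bias i w x + T.bias i w y),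
      sq_nonneg (T.bias i w x - T.bias i w y)]
  linarith [sum_bias_sq_le T x, sum_bias_sq_le T y]

theorem biasKernel_diag_le (A : CommLearner X n) (x : X) : A.biasKernel x x ≤ 2 * n := by
  have h : A.biasKernel x x ≤ ∑' T, (A T).toReal * (2 * n) :=
    Summable.tsum_le_tsum
      (fun T => mul_le_mul_of_nonneg_left (sum_bias_sq_le T x) ENNReal.toReal_nonneg)
      (PMF.summable_toReal_mul A fun T _ => abs_sum_bias_mul_le T x x)
      (A.summable_toReal.mul_right _)
  rwa [tsum_mul_right, PMF.tsum_toReal, one_mul] at h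

/-- Writing the quadratic form as an expected sum of squares yields both its positivity and its link
to the effect of flipping labels. -/
theorem sum_sum_mul_biasKernel [Fintype X] (A : CommLearner X n) (c : X → ℝ) :
    ∑ x, ∑ y, c x * c y * A.biasKernel x y =
      ∑' T, (A T).toReal * ∑ i, ∑ w, (∑ x, c x * T.bias i w x) ^ 2 := by
  have hs : ∀ x y, Summable fun T => c x * c y *
      ((A T).toReal * ∑ i, ∑ w, T.bias i w x * T.bias i w y) := fun x y =>
    (PMF.summable_toReal_mul A fun T _ => abs_sum_bias_mul_le T x y).mul_left _
  simp_rw [biasKernel, ← tsum_mul_left]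
  simp_rw [← Summable.tsum_finsetSum fun y (_ : y ∈ Finset.univ) => hs _ y]
  rw [← Summable.tsum_finsetSum fun x _ => summable_sum fun y _ => hs x y]
  refine tsum_congr fun T => ?_
  have hsq : ∑ i, ∑ w, (∑ x, c x * T.bias i w x) ^ 2 =
      ∑ x, ∑ y, c x * c y * ∑ i, ∑ w, T.bias i w x * T.bias i w y := by
    have hi : ∀ i, ∑ w, (∑ x, c x * T.bias i w x) ^ 2 =
        ∑ x, ∑ y, c x * c y * ∑ w, T.bias i w x * T.bias i w y := by
      intro i
      simp_rw [sq, Finset.sum_mul_sum, Finset.mul_sum]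
      rw [Finset.sum_comm]
      refine Finset.sum_congr rfl fun x _ => ?_
      rw [Finset.sum_comm]
      exact Finset.sum_congr rfl fun y _ => Finset.sum_congr rfl fun w _ => by ring
    simp_rw [hi, Finset.mul_sum (ι := Fin n)]
    rw [Finset.sum_comm]
    refine Finset.sum_congr rfl fun x _ => ?_
    rw [Finset.sum_comm]
  rw [hsq, Finset.mul_sum]
  refine Finset.sum_congr rfl fun x _ => ?_
  rw [Finset.mul_sum]
  exact Finset.sum_congr rfl fun y _ => by ring

theorem summable_toReal_mul_sum_sq [Fintype X] (A : CommLearner X n) (c : X → ℝ) :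
    Summable fun T => (A T).toReal * ∑ i, ∑ w, (∑ x, c x * T.bias i w x) ^ 2 := by
  refine PMF.summable_toReal_mul A (B := (∑ x, c x ^ 2) * ∑ _x : X, (2 * n : ℝ)) fun T _ => ?_
  rw [abs_of_nonneg (Finset.sum_nonneg fun i _ => Finset.sum_nonneg fun w _ => sq_nonneg _)]
  calc ∑ i, ∑ w, (∑ x, c x * T.bias i w x) ^ 2
      ≤ ∑ i, ∑ w, (∑ x, c x ^ 2) * ∑ x, T.bias i w x ^ 2 :=
        Finset.sum_le_sum fun i _ => Finset.sum_le_sum fun w _ =>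
          Finset.sum_mul_sq_le_sq_mul_sq _ _ _
    _ = (∑ x, c x ^ 2) * ∑ x, ∑ i, ∑ w, T.bias i w x * T.bias i w x := by
        simp_rw [← Finset.mul_sum, sq]
        congr 1
        rw [Finset.sum_comm]
        exact Finset.sum_congr rfl fun i _ => Finset.sum_comm
    _ ≤ _ := mul_le_mul_of_nonneg_left (Finset.sum_le_sum fun x _ => sum_bias_sq_le T x)
        (Finset.sum_nonneg fun x _ => sq_nonneg _)

theorem posSemidef_biasKernel [Fintype X] (A : CommLearner X n) : A.biasKernel.PosSemidef := by
  refine Matrix.PosSemidef.of_dotProduct_mulVec_nonneg (Matrix.IsHermitian.ext fun x y => ?_)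
    fun c => ?_
  · simp only [biasKernel, star_trivial, mul_comm (CommProtocol.bias _ _ _ y)]
  · have h : star c ⬝ᵥ (A.biasKernel.mulVec c) = ∑ x, ∑ y, c x * c y * A.biasKernel x y := by
      simp only [dotProduct, Matrix.mulVec, star_trivial, Finset.mul_sum]
      exact Finset.sum_congr rfl fun x _ => Finset.sum_congr rfl fun y _ => by ring
    rw [h, sum_sum_mul_biasKernel]
    exact tsum_nonneg fun T => mul_nonneg ENNReal.toReal_nonneg
      (Finset.sum_nonneg fun i _ => Finset.sum_nonneg fun w _ => sq_nonneg _)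

/-- No hypothesis has error less than `1/2` for both `f` and `-f`. -/
theorem disjoint_error_lt_half (D : PMF X) (f : X → ℤˣ) :
    Disjoint {h : X → ℤˣ | D.toOuterMeasure {x | f x ≠ h x} < 1 / 2}
      {h : X → ℤˣ | D.toOuterMeasure {x | (-f) x ≠ h x} < 1 / 2} := by
  refine Set.disjoint_left.2 fun h h₁ h₂ => ?_
  have hcov : Set.univ ⊆ {x | f x ≠ h x} ∪ {x | (-f) x ≠ h x} := by
    intro x _
    by_contra hx
    simp only [Set.mem_union, Set.mem_ofPred_eq, not_or, not_not, Pi.neg_apply] at hx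
    exact units_ne_neg_self (f x) (hx.1.trans hx.2.symm)
  have h1 : (1 : ENNReal) ≤
      D.toOuterMeasure {x | f x ≠ h x} + D.toOuterMeasure {x | (-f) x ≠ h x} := by
    rw [← (D.toOuterMeasure_apply_eq_one_iff Set.univ).2 (Set.subset_univ _)]
    exact (MeasureTheory.measure_mono hcov).trans (MeasureTheory.measure_union_le _ _)
  refine (h1.trans_lt (ENNReal.add_lt_add h₁ h₂)).ne ?_
  rw [ENNReal.add_halves]

theorem prob_hypothesisLaw (A : CommLearner X n) (D : PMF X) (f : X → ℤˣ) (E : Set (X → ℤˣ)) :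
    (A.hypothesisLaw D f).prob E = ∑' T, (A T).toReal *
      ((iidPMF (D.map fun x => (x, f x)) n).bind fun S => T.law S).prob E :=
  PMF.prob_bind A _ E

/-- A sum of at most `N` absolute values, bounded through the sum of the squares. -/
theorem sum_abs_le_mul_sum_sq_add {ι : Type*} [Fintype ι] (u : ι → ℝ) {N : ℝ} (hN : 0 < N)
    (hcard : Fintype.card ι ≤ N) : ∑ i, |u i| ≤ N * ∑ i, u i ^ 2 + 1 / 4 := by
  -- AM-GM weighted so that the constants add up to at most 1/4 over `N` terms. Unlike
  -- Cauchy–Schwarz, it is linear in the squares and can be averaged over `T` directly.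
  have h : ∀ i, |u i| ≤ N * u i ^ 2 + 1 / (4 * N) := by
    intro i
    have h4 : N * u i ^ 2 + 1 / (4 * N) - |u i| = (2 * N * |u i| - 1) ^ 2 / (4 * N) := by
      rw [← sq_abs (u i)]
      field_simp
      ring
    have h5 : 0 ≤ (2 * N * |u i| - 1) ^ 2 / (4 * N) := by positivity
    linarith
  refine (Finset.sum_le_sum fun i _ => h i).trans ?_
  rw [Finset.sum_add_distrib, ← Finset.mul_sum, Finset.sum_const, Finset.card_univ, nsmul_eq_mul]
  have h6 : (Fintype.card ι : ℝ) * (1 / (4 * N)) ≤ N * (1 / (4 * N)) :=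
    mul_le_mul_of_nonneg_right hcard (by positivity)
  have h7 : N * (1 / (4 * N)) = 1 / 4 := by field_simp
  linarith

/-- A weak learner for `f` and `-f` has answers whose biases correlate with `f`. -/
theorem le_sum_sum_mul_biasKernel [Fintype X] {A : CommLearner X n} {C : Set (X → ℤˣ)} {ℓ : ℕ}
    (hb : A.IsCommBounded ℓ) (hna : A.LabelNonAdaptive) (hA : A.WeakPACLearns C (3 / 4))
    {f : X → ℤˣ} (hf : f ∈ C) (hf' : -f ∈ C) (D : PMF X) :
    1 / 4 ≤ (n * 2 ^ ℓ : ℝ) * ∑ x, ∑ y, ((D x).toReal * ((f x : ℤˣ) : ℤ)) *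
      ((D y).toReal * ((f y : ℤˣ) : ℤ)) * A.biasKernel x y := by
  set c : X → ℝ := fun x => (D x).toReal * ((f x : ℤˣ) : ℤ) with hc
  rw [sum_sum_mul_biasKernel A c]
  set E := {h : X → ℤˣ | D.toOuterMeasure {x | f x ≠ h x} < 1 / 2} with hE
  set E' := {h : X → ℤˣ | D.toOuterMeasure {x | (-f) x ≠ h x} < 1 / 2} with hE'
  have h34 : (3 / 4 : ENNReal).toReal = 3 / 4 := by simp
  have h1 : 3 / 4 ≤ (A.hypothesisLaw D f).prob E := by
    rw [← h34]
    exact ENNReal.toReal_mono ((PMF.toOuterMeasure_le_one _ _).trans_lt ENNReal.one_lt_top).ne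
      (hA D f hf)
  have h2 : 3 / 4 ≤ (A.hypothesisLaw D (-f)).prob E' := by
    rw [← h34]
    exact ENNReal.toReal_mono ((PMF.toOuterMeasure_le_one _ _).trans_lt ENNReal.one_lt_top).ne
      (hA D (-f) hf')
  rw [prob_hypothesisLaw] at h1 h2
  have hsum : ∀ (g : X → ℤˣ) (F : Set (X → ℤˣ)), Summable fun T => (A T).toReal *
      ((iidPMF (D.map fun x => (x, g x)) n).bind fun S => T.law S).prob F := fun g F =>
    PMF.summable_toReal_mul A (B := 1) fun T _ => by
      rw [abs_of_nonneg (PMF.prob_nonneg _ _)]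
      exact PMF.prob_le_one _ _
  have hsq := summable_toReal_mul_sum_sq A c
  -- For each `T`, disjointness gives 1 and the flip costs N Σ u² + 1/4. Against the average success
  -- 3/4 + 3/4 this leaves 1/4 for N times the expected squares.
  have hle : ∀ T, (A T).toReal *
        ((iidPMF (D.map fun x => (x, f x)) n).bind fun S => T.law S).prob E +
      (A T).toReal *
        ((iidPMF (D.map fun x => (x, (-f) x)) n).bind fun S => T.law S).prob E' ≤
      (A T).toReal * (5 / 4) + (n * 2 ^ ℓ : ℝ) *
        ((A T).toReal * ∑ i, ∑ w, (∑ x, c x * T.bias i w x) ^ 2) := by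
    intro T
    by_cases hT : T ∈ A.support
    · have hflip := (abs_le.1 (abs_prob_sub_prob_neg_le (hna T hT) D f E)).2
      have hdisj := PMF.prob_add_le_one
        ((iidPMF (D.map fun x => (x, (-f) x)) n).bind fun S => T.law S)
        (disjoint_error_lt_half D f)
      have hbound : ∑ i, ∑ w, |∑ x, c x * T.bias i w x| ≤
          (n * 2 ^ ℓ : ℝ) * ∑ i, ∑ w, (∑ x, c x * T.bias i w x) ^ 2 + 1 / 4 := by
        obtain rfl | hn := Nat.eq_zero_or_pos n
        · simp
        · have := sum_abs_le_mul_sum_sq_add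
            (fun p : Σ i, Answers (T.fixedQueries i) => ∑ x, c x * T.bias p.1 p.2 x)
            (N := n * 2 ^ ℓ) (by positivity) (by
              rw [Fintype.card_sigma]
              have := Finset.sum_le_card_nsmul Finset.univ _ _ fun i _ =>
                card_answers_fixedQueries_le (hb T hT) i
              rw [Finset.card_univ, Fintype.card_fin, smul_eq_mul] at this
              exact_mod_cast this)
          rwa [Fintype.sum_sigma, Fintype.sum_sigma] at this
      have hmain := mul_le_mul_of_nonneg_left
        (show ((iidPMF (D.map fun x => (x, f x)) n).bind fun S => T.law S).prob E +
          ((iidPMF (D.map fun x => (x, (-f) x)) n).bind fun S => T.law S).prob E' ≤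
          5 / 4 + (n * 2 ^ ℓ : ℝ) * ∑ i, ∑ w, (∑ x, c x * T.bias i w x) ^ 2 by linarith)
        (ENNReal.toReal_nonneg : 0 ≤ (A T).toReal)
      linarith
    · simp [(A.apply_eq_zero_iff T).2 hT]
  have htot := Summable.tsum_le_tsum hle ((hsum f E).add (hsum (-f) E'))
    ((A.summable_toReal.mul_right _).add (hsq.mul_left _))
  rw [Summable.tsum_add (hsum f E) (hsum (-f) E'),
    Summable.tsum_add (A.summable_toReal.mul_right _) (hsq.mul_left _), tsum_mul_right,
    tsum_mul_left, PMF.tsum_toReal] at htot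
  linarith

end CommLearner

/-! ### ### From the kernel to the lower bound -/

/-- The margin condition is vacuous, so every M > 0 is admissible. Here learning says nothing, as
there is no D or no `f`. -/
theorem marginComplexity_eq_zero_of_trivial {X : Type*} (C : Set (X → ℤˣ))
    (h : IsEmpty X ∨ C = ∅) : marginComplexity C = 0 := by
  have hset : ∀ M : ℝ, 0 < M → marginComplexity C ≤ M := fun M hM =>
    csInf_le ⟨0, fun M hM => hM.1.le⟩ ⟨hM, 0, fun _ => 0, by simp, fun f hf => ⟨0, by simp, by
      obtain h | h := h
      · exact fun x => h.elim x
      · simp [h] at hf⟩⟩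
  exact le_antisymm (le_of_forall_pos_le_add fun ε hε => by simpa using hset ε hε)
    (Real.sInf_nonneg fun M hM => hM.1.le)

theorem mainTheorem8 :
    ∃ c : ℝ, 0 < c ∧
      ∀ (X : Type*) [Finite X] (C : Set (X → ℤˣ)), (∀ f ∈ C, -f ∈ C) →
        ∀ (ℓ n : ℕ) (A : CommLearner X n),
          A.IsCommBounded ℓ → A.LabelNonAdaptive → A.WeakPACLearns C (3 / 4) →
            c * marginComplexity C ^ (2 / 3 : ℝ) / 2 ^ ℓ ≤ (n : ℝ) := by
  refine ⟨1 / 2, by norm_num, fun X _ C hC ℓ n A hb hna hA => ?_⟩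
  classical
  have := Fintype.ofFinite X
  by_cases htriv : IsEmpty X ∨ C = ∅
  · rw [marginComplexity_eq_zero_of_trivial C htriv, Real.zero_rpow (by norm_num)]
    simp
  rw [not_or, not_isEmpty_iff, ← ne_eq, ← Set.nonempty_iff_ne_empty] at htriv
  obtain ⟨hX, f₀, hf₀⟩ := htriv
  have hcorr : ∀ f ∈ C, ∀ D : PMF X, _ := fun f hf D =>
    CommLearner.le_sum_sum_mul_biasKernel hb hna hA hf (hC f hf) D
  obtain rfl | hn := Nat.eq_zero_or_pos n
  -- Without samples the correlation bound reads 1/4 ≤ 0.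
  · have := hcorr f₀ hf₀ (PMF.pure (Classical.arbitrary X))
    norm_num at this
  set N : ℝ := n * 2 ^ ℓ with hN
  have hn1 : (1 : ℝ) ≤ n := by exact_mod_cast hn
  have h2 : (1 : ℝ) ≤ 2 ^ ℓ := one_le_pow₀ (by norm_num)
  have hN1 : 1 ≤ N := one_le_mul_of_one_le_of_one_le hn1 h2
  have hnN : (n : ℝ) ≤ N := le_mul_of_one_le_right (by positivity) h2
  have hM2 : ((2 * N) ^ (3 / 2 : ℝ)) ^ 2 = 8 * N ^ 3 := by
    rw [← Real.rpow_natCast, ← Real.rpow_mul (by positivity)]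
    norm_num
    ring
  -- The kernel only needs M² ≥ 8nN. The choice M² = 8N³ is weaker, since n ≤ N ≤ N², and fits the
  -- exponent 2/3.
  have hmc : marginComplexity C ≤ (2 * N) ^ (3 / 2 : ℝ) := by
    refine marginComplexity_le_of_posSemidef C A.biasKernel A.posSemidef_biasKernel
      (a := 1 / (4 * N)) (B := 2 * n) (by positivity) (by positivity) ?_ A.biasKernel_diag_le
      fun f hf D hD hD1 => ?_
    · rw [hM2]
      have : 1 / (4 * N) * (8 * N ^ 3) = 2 * N ^ 2 := by field_simp; ring
      rw [this]
      nlinarith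
    · have hPMF : ∑ x, ENNReal.ofReal (D x) = 1 := by
        rw [← ENNReal.ofReal_sum_of_nonneg fun x _ => hD x, hD1, ENNReal.ofReal_one]
      have h := hcorr f hf (PMF.ofFintype _ hPMF)
      simp only [PMF.ofFintype_apply, ENNReal.toReal_ofReal (hD _)] at h
      rw [div_le_iff₀ (by positivity)]
      linarith
  have hmc0 : 0 ≤ marginComplexity C := Real.sInf_nonneg fun M hM => hM.1.le
  have hpow : marginComplexity C ^ (2 / 3 : ℝ) ≤ 2 * N := by
    refine (Real.rpow_le_rpow hmc0 hmc (by norm_num)).trans_eq ?_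
    rw [← Real.rpow_mul (by positivity)]
    norm_num
  rw [div_le_iff₀ (by positivity)]
  linarith
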